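/- Let $m\ge n\ge 1$, $A\in\mathbb R^{m\times n}$, $b\in\mathbb R^m$, and let $\|\cdot\|$ denote the Euclidean norm. The total least squares (TLS) problem with data $A,b$ is $$\min_{E,f}\ \|(E\mid f)\|_F\quad\text{subject to}\quad b+f\in\operatorname{Im}(A+E),\qquad E\in\mathbb R^{m\times n},\ f\in\mathbb R^m .$$ A vector $x\in\mathbb R^n$ is a TLS solution if $(A+\bar E)x=b+\bar f$ for some $(\bar E\mid\bar f)$ attaining this minimum. Assume the problem is well posed, i.e. it has exactly one TLS solution, denoted $x_{\mathrm{TLS}}$. Let $\sigma_1\ge\dots\ge\sigma_n\ge\sigma_{n+1}\ge0$ be the singular values of the $m\times(n+1)$ matrix $C=(A\mid b)$, that is, the square roots of the eigenvalues of $C^TC$ counted with multiplicity. Put $$\mu(x)=\frac1{\sqrt{1+x^Tx}},\quad f(x)=\mu(x)(Ax-b),\quad \eta(x)=\frac{\|Ax-b\|}{\sqrt{1+x^Tx}},\quad J(x)=\mu(x)A-\mu(x)^3(Ax-b)x^T .$$ Let $(x_k)_{k\ge0}$ be generated by Algorithm GN-TLS with "optimal" step length, run without a stopping test: $x_0=x_{\mathrm{LS}}$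 minimizes $\|Ax-b\|$ and, for $k=0,1,2,\dots$, $$h_k\in\arg\min_{h\in\mathbb R^n}\|J(x_k)h+f(x_k)\|,\qquad \alpha_k=\frac1{1-\mu(x_k)^2\,x_k^Th_k},\qquad x_{k+1}=x_k+\alpha_kh_k .$$ Then $\sigma_n>\sigma_{n+1}$; the denominators $1-\mu(x_k)^2x_k^Th_k$ never vanish, so that all step lengths $\alpha_k$ are well defined; and, as $k\to\infty$, $$\|f(x_k)-f(x_{\mathrm{TLS}})\|=O\big((\sigma_{n+1}/\sigma_n)^{2k}\big),\qquad |\eta(x_k)-\sigma_{n+1}|=O\big((\sigma_{n+1}/\sigma_n)^{4k}\big),$$ $$\|x_k-x_{\mathrm{TLS}}\|=O\big((\sigma_{n+1}/\sigma_n)^{2k}\big).$$ -/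

import Mathlib

open Filter Asymptotics

namespace TLS

noncomputable section

variable {m n : ℕ}

/-- The augmented matrix `(E | f)`: the first `n` columns are those of `E`, the last one is `f`. -/
def augment (E : Matrix (Fin m) (Fin n) ℝ) (f : EuclideanSpace ℝ (Fin m)) :
    Matrix (Fin m) (Fin n ⊕ Unit) ℝ :=
  Matrix.fromCols E (Matrix.replicateCol Unit f)

section Frobenius

attribute [local instance] Matrix.frobeniusNormedAddCommGroup

/-- The Frobenius norm of the augmented matrix `(E | f)`. -/
def frobeniusNorm (E : Matrix (Fin m) (Fin n) ℝ) (f : EuclideanSpace ℝ (Fin m)) : ℝ :=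
  ‖augment E f‖

end Frobenius

/-- `(E, f)` is a feasible perturbation: `b + f` belongs to the range of `A + E`. -/
def IsFeasible (A : Matrix (Fin m) (Fin n) ℝ) (b : EuclideanSpace ℝ (Fin m))
    (E : Matrix (Fin m) (Fin n) ℝ) (f : EuclideanSpace ℝ (Fin m)) : Prop :=
  b + f ∈ LinearMap.range (A + E).toEuclideanLin

/-- `(E, f)` attains the minimum of `‖(E | f)‖_F` over all feasible perturbations. -/
def IsMinimalPerturbation (A : Matrix (Fin m) (Fin n) ℝ) (b : EuclideanSpace ℝ (Fin m))
    (E : Matrix (Fin m) (Fin n) ℝ) (f : EuclideanSpace ℝ (Fin m)) : Prop :=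
  IsFeasible A b E f ∧
    ∀ (E' : Matrix (Fin m) (Fin n) ℝ) (f' : EuclideanSpace ℝ (Fin m)),
      IsFeasible A b E' f' → frobeniusNorm E f ≤ frobeniusNorm E' f'

/-- `x` is a solution of the total least squares problem with data `A`, `b`. -/
def IsSolution (A : Matrix (Fin m) (Fin n) ℝ) (b : EuclideanSpace ℝ (Fin m))
    (x : EuclideanSpace ℝ (Fin n)) : Prop :=
  ∃ (E : Matrix (Fin m) (Fin n) ℝ) (f : EuclideanSpace ℝ (Fin m)),
    IsMinimalPerturbation A b E f ∧ (A + E).toEuclideanLin x = b + f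

/-- Well-posedness: the total least squares solution exists and is unique. -/
def WellPosed (A : Matrix (Fin m) (Fin n) ℝ) (b : EuclideanSpace ℝ (Fin m)) : Prop :=
  ∃! x : EuclideanSpace ℝ (Fin n), IsSolution A b x

/-- The singular values `σ₁ ≥ σ₂ ≥ … ≥ σ_{n+1}` of `C = (A | b)`, numbered from `1`
(Mathlib's `LinearMap.singularValues` is numbered from `0`); only used for `i ≥ 1`. -/
def sigma (A : Matrix (Fin m) (Fin n) ℝ) (b : EuclideanSpace ℝ (Fin m)) (i : ℕ) : ℝ :=
  (augment A b).toEuclideanLin.singularValues (i - 1)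

/-- `μ(x) = 1 / √(1 + xᵀx)`. -/
def mu (x : EuclideanSpace ℝ (Fin n)) : ℝ :=
  1 / √(1 + inner ℝ x x)

/-- `f(x) = μ(x) (A x - b)`. -/
def resid (A : Matrix (Fin m) (Fin n) ℝ) (b : EuclideanSpace ℝ (Fin m))
    (x : EuclideanSpace ℝ (Fin n)) : EuclideanSpace ℝ (Fin m) :=
  mu x • (A.toEuclideanLin x - b)

/-- `η(x) = ‖A x - b‖ / √(1 + xᵀx)`. -/
def eta (A : Matrix (Fin m) (Fin n) ℝ) (b : EuclideanSpace ℝ (Fin m))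
    (x : EuclideanSpace ℝ (Fin n)) : ℝ :=
  ‖A.toEuclideanLin x - b‖ / √(1 + inner ℝ x x)

/-- The Jacobian matrix of `f`: `J(x) = μ(x) A - μ(x)³ (A x - b) xᵀ`. -/
def jac (A : Matrix (Fin m) (Fin n) ℝ) (b : EuclideanSpace ℝ (Fin m))
    (x : EuclideanSpace ℝ (Fin n)) : Matrix (Fin m) (Fin n) ℝ :=
  mu x • A - mu x ^ 3 • Matrix.vecMulVec (A.toEuclideanLin x - b) x

/-- The denominator `1 - μ(x)² xᵀh` of the "optimal" step length. -/
def stepDenom (x h : EuclideanSpace ℝ (Fin n)) : ℝ :=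
  1 - mu x ^ 2 * inner ℝ x h

/-- The "optimal" step length `α = 1 / (1 - μ(x)² xᵀh)`. -/
def stepLength (x h : EuclideanSpace ℝ (Fin n)) : ℝ :=
  1 / stepDenom x h

/-- `x` is the sequence of iterates and `h` the sequence of Gauss-Newton steps of Algorithm GN-TLS
with "optimal" step length, run without a stopping test. -/
structure IsRun (A : Matrix (Fin m) (Fin n) ℝ) (b : EuclideanSpace ℝ (Fin m))
    (x h : ℕ → EuclideanSpace ℝ (Fin n)) : Prop where
  /-- `x₀ = argmin ‖A y - b‖`, the ordinary least squares solution. -/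
  init : ∀ y : EuclideanSpace ℝ (Fin n), ‖A.toEuclideanLin (x 0) - b‖ ≤ ‖A.toEuclideanLin y - b‖
  /-- `h_k = argmin ‖J(x_k) y + f(x_k)‖`. -/
  step : ∀ (k : ℕ) (y : EuclideanSpace ℝ (Fin n)),
    ‖(jac A b (x k)).toEuclideanLin (h k) + resid A b (x k)‖ ≤
      ‖(jac A b (x k)).toEuclideanLin y + resid A b (x k)‖
  /-- `x_{k+1} = x_k + α_k h_k`. -/
  update : ∀ k : ℕ, x (k + 1) = x k + stepLength (x k) (h k) • h k

end

end TLS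

/-! Write `C = (A | b)`, `M = Cᵀ C` and `e = (0, 1)`. The minimal cost of a perturbation making `x`
an exact solution is `η(x)`, the square root of the Rayleigh quotient of `M` at `(x, -1)`
(`isSolution_iff`). Existence and uniqueness of the minimizer force the smallest eigenvalue of `M`
to be simple, with eigenvector `(x_TLS, -1)` (`spectral_gap_of_unique_minimizer`).

The linearised residual is `μ C z`, where `z = (h + d x, -d)` and `d` is the step denominator. As
`h` varies, `z` runs over an affine hyperplane orthogonal to `(x, -1)`, so the least squares
condition reads `M z = c (x, -1)`. The optimal step length rescales `z` to last coordinate `-1`.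
Thus the algorithm is inverse iteration for `M` (`IsRun.inverse_iteration`), started at `e` since `M
(x_LS, -1)` is a multiple of `e`. Its contraction ratio is `σ_{n+1}² / σ_n²`; the rate for `η` is
squared because a Rayleigh quotient is stationary at an eigenvector. If `σ_{n+1} = 0`, then `M` is
singular, but `b = A x_TLS` and the iteration is constant. -/

namespace TLS

/-! ### Inverse iteration and the smallest singular value -/

section LinearAlgebra

variable {E F : Type*} [NormedAddCommGroup E] [InnerProductSpace ℝ E]
  [NormedAddCommGroup F] [InnerProductSpace ℝ F]

/-- First order optimality condition for a minimum of the norm along a line. -/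
theorem inner_eq_zero_of_norm_le_add_smul {a b : F} (h : ∀ t : ℝ, ‖a‖ ≤ ‖a + t • b‖) :
    inner ℝ a b = 0 := by
  have key : ∀ t : ℝ, 0 ≤ (‖b‖ ^ 2) * (t * t) + (2 * inner ℝ a b) * t + 0 := by
    intro t
    have h1 : ‖a‖ ^ 2 ≤ ‖a + t • b‖ ^ 2 := pow_le_pow_left₀ (norm_nonneg _) (h t) 2
    rw [norm_add_sq_real, inner_smul_right, norm_smul, mul_pow, Real.norm_eq_abs, sq_abs] at h1
    nlinarith
  -- The quadratic has zero constant term, so its discriminant is `4 ⟪a, b⟫²`.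
  have := discrim_le_zero key
  simp only [discrim, mul_zero, sub_zero] at this
  nlinarith [sq_nonneg (inner ℝ a b)]

/-- A vector orthogonal to everything orthogonal to `v` is a multiple of `v`. -/
theorem exists_eq_smul_of_forall_inner_eq_zero {v y : E} (hv : v ≠ 0)
    (h : ∀ w, inner ℝ v w = 0 → inner ℝ y w = 0) : ∃ c : ℝ, y = c • v := by
  refine ⟨inner ℝ v y / ‖v‖ ^ 2, ?_⟩
  have hv' : ‖v‖ ^ 2 ≠ 0 := by simpa using hv
  set w := y - (inner ℝ v y / ‖v‖ ^ 2) • v with hw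
  have h1 : inner ℝ v w = 0 := by
    rw [hw, inner_sub_right, inner_smul_right, real_inner_self_eq_norm_sq]
    field_simp
    ring
  have h2 : inner ℝ w w = 0 := by
    nth_rewrite 1 [hw]
    rw [inner_sub_left, inner_smul_left, h1, h w h1]
    simp
  exact sub_eq_zero.mp (inner_self_eq_zero.mp h2)

/-- If the Rayleigh quotient of `T† T` is minimal at `u` among the vectors not orthogonal to `e`,
then it is minimal at `u`. -/
theorem rayleigh_le_of_forall_inner_ne_zero [FiniteDimensional ℝ E] (T : E →ₗ[ℝ] F) {e u : E}
    (hu : inner ℝ e u ≠ 0)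
    (hmin : ∀ v, inner ℝ e v ≠ 0 → ‖T u‖ ^ 2 * ‖v‖ ^ 2 ≤ ‖T v‖ ^ 2 * ‖u‖ ^ 2) (v : E) :
    ‖T u‖ ^ 2 * ‖v‖ ^ 2 ≤ ‖T v‖ ^ 2 * ‖u‖ ^ 2 := by
  by_cases hv : inner ℝ e v = 0
  swap
  · exact hmin v hv
  have hT : Continuous T := T.continuous_of_finiteDimensional
  -- Density: `v + t • u` leaves the hyperplane `e⊥` for every `t ≠ 0`; then let `t → 0`.
  have hc : Continuous fun t : ℝ =>
      ‖T (v + t • u)‖ ^ 2 * ‖u‖ ^ 2 - ‖T u‖ ^ 2 * ‖v + t • u‖ ^ 2 := by fun_prop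
  have h1 : Tendsto (fun t : ℝ => ‖T (v + t • u)‖ ^ 2 * ‖u‖ ^ 2 - ‖T u‖ ^ 2 * ‖v + t • u‖ ^ 2)
      (nhdsWithin 0 {0}ᶜ) (nhds (‖T v‖ ^ 2 * ‖u‖ ^ 2 - ‖T u‖ ^ 2 * ‖v‖ ^ 2)) := by
    have := (hc.tendsto 0).mono_left (nhdsWithin_le_nhds (s := {0}ᶜ))
    simpa using this
  refine sub_nonneg.mp (ge_of_tendsto h1 ?_)
  filter_upwards [self_mem_nhdsWithin] with t ht
  refine sub_nonneg.mpr (hmin _ ?_)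
  rw [inner_add_right, inner_smul_right, hv, zero_add]
  exact mul_ne_zero ht hu

/-- Powers of a symmetric operator that expands the orthogonal complement of an eigenvector `u`
by a factor `κ` expand it by the corresponding powers of `κ`. -/
theorem pow_mul_norm_le_norm_pow_apply {M : E →ₗ[ℝ] E} (hM : M.IsSymmetric) {u : E} {τ κ : ℝ}
    (hMu : M u = τ • u) (hκ : 0 ≤ κ) (hexp : ∀ w, inner ℝ u w = 0 → κ * ‖w‖ ≤ ‖M w‖) (k : ℕ)
    {w : E} (hw : inner ℝ u w = 0) :
    inner ℝ u ((M ^ k) w) = 0 ∧ κ ^ k * ‖w‖ ≤ ‖(M ^ k) w‖ := by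
  induction k with
  | zero => simpa using hw
  | succ k ih =>
    rw [pow_succ' M, Module.End.mul_apply]
    constructor
    · rw [← hM, hMu, inner_smul_left, ih.1, mul_zero]
    · calc κ ^ (k + 1) * ‖w‖ = κ * (κ ^ k * ‖w‖) := by ring
        _ ≤ κ * ‖(M ^ k) w‖ := mul_le_mul_of_nonneg_left ih.2 hκ
        _ ≤ _ := hexp _ ih.1

/-- Convergence of the inverse iteration `M ^ (k + 1) (v k) = c k • e`, normalised by
`⟪e, v k⟫ = ⟪e, u⟫`, to the eigenvector `u` of the smallest eigenvalue. -/
theorem inverse_iteration_convergence {M : E →ₗ[ℝ] E} (hM : M.IsSymmetric) {e u : E} {τ κ : ℝ}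
    (hMu : M u = τ • u) (hτ : 0 < τ) (hτκ : τ < κ)
    (hexp : ∀ w, inner ℝ u w = 0 → κ * ‖w‖ ≤ ‖M w‖) (hu : inner ℝ e u ≠ 0)
    {v : ℕ → E} {c : ℕ → ℝ} (hv : ∀ k, inner ℝ e (v k) = inner ℝ e u)
    (hc : ∀ k, (M ^ (k + 1)) (v k) = c k • e) :
    ∃ (a : ℕ → ℝ) (w : ℕ → E), (∀ k, v k = a k • u + w k) ∧ (∀ k, inner ℝ u (w k) = 0) ∧
      w =O[atTop] (fun k => (τ / κ) ^ k) ∧ (fun k => a k - 1) =O[atTop] (fun k => (τ / κ) ^ k) := by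
  have hu0 : u ≠ 0 := by rintro rfl; simp at hu
  have hκ : 0 < κ := hτ.trans hτκ
  have hU : 0 < ‖u‖ ^ 2 := by positivity
  have hdec : ∀ y : E, inner ℝ u (y - (inner ℝ u y / ‖u‖ ^ 2) • u) = 0 := by
    intro y
    rw [inner_sub_right, inner_smul_right, real_inner_self_eq_norm_sq]
    field_simp
    ring
  set a : ℕ → ℝ := fun k => inner ℝ u (v k) / ‖u‖ ^ 2 with ha
  set w : ℕ → E := fun k => v k - a k • u with hw
  have hvaw : ∀ k, v k = a k • u + w k := fun k => by simp [hw]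
  have hwu : ∀ k, inner ℝ u (w k) = 0 := fun k => hdec (v k)
  set ε : ℝ := inner ℝ u e / ‖u‖ ^ 2 with hε
  set e' : E := e - ε • u with he'
  have he'u : inner ℝ u e' = 0 := hdec e
  have hε0 : ε ≠ 0 := div_ne_zero (by rwa [real_inner_comm]) hU.ne'
  have hpowu : ∀ k, (M ^ k) u = τ ^ k • u := by
    intro k
    induction k with
    | zero => simp
    | succ k ih => rw [pow_succ', Module.End.mul_apply, ih, map_smul, hMu, smul_smul, pow_succ]
  -- The left side is a multiple of `u` and the right side is orthogonal to `u`, so both vanish.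
  have hsplit : ∀ k, (a k * τ ^ (k + 1) - c k * ε) • u =
      c k • e' - (M ^ (k + 1)) (w k) := by
    intro k
    have h1 := hc k
    rw [hvaw k, map_add, map_smul, hpowu] at h1
    have h2 : (M ^ (k + 1)) (w k) = c k • e - a k • τ ^ (k + 1) • u := by rw [← h1]; abel
    rw [h2, he', sub_smul, smul_sub, smul_smul, smul_smul]
    abel
  have hak : ∀ k, a k * τ ^ (k + 1) = c k * ε := by
    intro k
    have h1 := congrArg (fun y => inner ℝ u y) (hsplit k)
    simp only [inner_sub_right, inner_smul_right, he'u,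
      (pow_mul_norm_le_norm_pow_apply hM hMu hκ.le hexp (k + 1) (hwu k)).1] at h1
    rw [mul_zero, sub_zero, real_inner_self_eq_norm_sq] at h1
    exact sub_eq_zero.mp ((mul_eq_zero.mp h1).resolve_right hU.ne')
  have hwk : ∀ k, ‖w k‖ ≤ |a k| * (‖e'‖ / |ε|) * (τ / κ) ^ (k + 1) := by
    intro k
    have h1 := hsplit k
    rw [hak k, sub_self, zero_smul] at h1
    have h2 := (pow_mul_norm_le_norm_pow_apply hM hMu hκ.le hexp (k + 1) (hwu k)).2
    rw [← sub_eq_zero.mp h1.symm, norm_smul, Real.norm_eq_abs] at h2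
    have h3 : |c k| = |a k| * τ ^ (k + 1) / |ε| := by
      rw [eq_div_iff (abs_ne_zero.mpr hε0), ← abs_mul, ← hak, abs_mul, abs_of_pos (pow_pos hτ _)]
    rw [h3] at h2
    rw [div_pow, mul_div_assoc', le_div_iff₀ (pow_pos hκ _)]
    calc ‖w k‖ * κ ^ (k + 1) = κ ^ (k + 1) * ‖w k‖ := mul_comm _ _
      _ ≤ _ := h2
      _ = _ := by ring
  set ρ : ℝ := τ / κ with hρ
  have hρ0 : 0 < ρ := div_pos hτ hκ
  have hρ1 : ρ < 1 := (div_lt_one hκ).mpr hτκ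
  have hak1 : ∀ k, (a k - 1) * inner ℝ e u = - inner ℝ e (w k) := by
    intro k
    have := hv k
    rw [hvaw k, inner_add_right, inner_smul_right] at this
    linarith
  have hak2 : ∀ k, |a k - 1| ≤ ‖e‖ / |inner ℝ e u| * ‖w k‖ := by
    intro k
    rw [div_mul_eq_mul_div, le_div_iff₀ (abs_pos.mpr hu), ← abs_mul, hak1, abs_neg]
    exact abs_real_inner_le_norm _ _
  set K : ℝ := ‖e'‖ / |ε| with hK
  set D : ℝ := ‖e‖ / |inner ℝ e u| with hD
  have hK0 : 0 ≤ K := by positivity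
  have hD0 : 0 ≤ D := by positivity
  have hwO : w =O[atTop] (fun k => ρ ^ k) := by
    have hlim : Tendsto (fun k : ℕ => D * K * ρ ^ (k + 1)) atTop (nhds 0) := by
      have := ((tendsto_pow_atTop_nhds_zero_of_lt_one hρ0.le hρ1).comp
        (tendsto_add_atTop_nat 1)).const_mul (D * K)
      simpa using this
    refine IsBigO.of_bound (2 * K * ρ) ?_
    -- `hwk` bounds `w` through `a`, and `hak2` bounds `a - 1` through `w`. Once `D * K * ρ ^ (k +
    -- 1) ≤ 1 / 2`, this gives `|a k| ≤ 1 + |a k| / 2`, which breaks the circle.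
    filter_upwards [hlim.eventually_le_const (show (0 : ℝ) < 1 / 2 by norm_num)] with k hk
    have h1 : |a k| ≤ 2 := by
      have h2 : |a k| - 1 ≤ |a k - 1| := by
        have := abs_sub_abs_le_abs_sub (a k) 1
        rwa [abs_one] at this
      have h3 : D * ‖w k‖ ≤ |a k| * (D * K * ρ ^ (k + 1)) := by
        calc D * ‖w k‖ ≤ D * (|a k| * K * ρ ^ (k + 1)) := mul_le_mul_of_nonneg_left (hwk k) hD0
          _ = _ := by ring
      have h4 : |a k| * (D * K * ρ ^ (k + 1)) ≤ |a k| * (1 / 2) :=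
        mul_le_mul_of_nonneg_left hk (abs_nonneg _)
      linarith [hak2 k]
    rw [Real.norm_of_nonneg (pow_nonneg hρ0.le k)]
    calc ‖w k‖ ≤ |a k| * K * ρ ^ (k + 1) := hwk k
      _ = |a k| * (K * ρ ^ (k + 1)) := by ring
      _ ≤ 2 * (K * ρ ^ (k + 1)) := mul_le_mul_of_nonneg_right h1 (by positivity)
      _ = 2 * K * ρ * ρ ^ k := by ring
  refine ⟨a, w, hvaw, hwu, hwO, IsBigO.trans ?_ hwO⟩
  exact IsBigO.of_bound D (Eventually.of_forall fun k => by
    rw [Real.norm_eq_abs]; exact hak2 k)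

variable [FiniteDimensional ℝ E] [FiniteDimensional ℝ F]

theorem inner_adjoint_comp_self (T : E →ₗ[ℝ] F) (v w : E) :
    inner ℝ ((T.adjoint ∘ₗ T) v) w = inner ℝ (T v) (T w) := by
  simp [LinearMap.adjoint_inner_left]

/-- If `T` is injective, every power of `T† T` is positive definite. -/
theorem eq_zero_of_inner_pow_adjoint_comp_self {T : E →ₗ[ℝ] F} (hT : Function.Injective T)
    (j : ℕ) (z : E) (h : inner ℝ (((T.adjoint ∘ₗ T) ^ j) z) z = 0) : z = 0 := by
  induction j using Nat.twoStepInduction generalizing z with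
  | zero => simpa using h
  | one =>
    rw [pow_one, inner_adjoint_comp_self, inner_self_eq_zero] at h
    exact (map_eq_zero_iff T hT).mp h
  | more j ih _ =>
    -- By symmetry `⟪M ^ (j + 2) z, z⟫ = ⟪M ^ j (M z), M z⟫`, hence the induction in steps of two.
    have h1 : (T.adjoint ∘ₗ T) z = 0 := by
      refine ih _ ?_
      rw [← h, pow_succ', pow_succ]
      exact (T.isSymmetric_adjoint_comp_self _ _).symm
    have h2 : inner ℝ (T z) (T z) = 0 := by
      rw [← inner_adjoint_comp_self, h1, inner_zero_left]
    exact (map_eq_zero_iff T hT).mp (inner_self_eq_zero.mp h2)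

/-- If the Rayleigh quotient of `T† T` on the hyperplane `⟪e, v⟫ = ⟪e, u⟫` attains its minimum
exactly at `u`, then the smallest singular value of `T` is simple and `u` is a corresponding
right singular vector. -/
theorem spectral_gap_of_unique_minimizer (T : E →ₗ[ℝ] F) {n : ℕ} (hn : 1 ≤ n)
    (hE : Module.finrank ℝ E = n + 1) {e u : E} (hu : inner ℝ e u ≠ 0)
    (hmin : ∀ v, inner ℝ e v ≠ 0 → ‖T u‖ ^ 2 * ‖v‖ ^ 2 ≤ ‖T v‖ ^ 2 * ‖u‖ ^ 2)
    (huniq : ∀ v, inner ℝ e v = inner ℝ e u → ‖T v‖ ^ 2 * ‖u‖ ^ 2 ≤ ‖T u‖ ^ 2 * ‖v‖ ^ 2 → v = u) :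
    T.singularValues n < T.singularValues (n - 1) ∧
    (T.adjoint ∘ₗ T) u = (T.singularValues n ^ 2) • u ∧
    ∀ w, inner ℝ u w = 0 → T.singularValues (n - 1) ^ 2 * ‖w‖ ≤ ‖(T.adjoint ∘ₗ T) w‖ := by
  set M := T.adjoint ∘ₗ T with hM
  set s : ℕ → ℝ := fun i => T.singularValues i with hs
  have hs0 : ∀ i, 0 ≤ s i := T.singularValues_nonneg
  have hanti : Antitone s := T.singularValues_antitone
  set B := T.isSymmetric_adjoint_comp_self.eigenvectorBasis hE with hB
  have hrep : ∀ v i, inner ℝ (B i) (M v) = s i ^ 2 * inner ℝ (B i) v := by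
    intro v i
    have := T.isSymmetric_adjoint_comp_self.eigenvectorBasis_apply_self_apply hE v i
    rw [B.repr_apply_apply, B.repr_apply_apply, ← T.sq_singularValues_fin hE i] at this
    exact this
  have hext : ∀ v w : E, (∀ i, inner ℝ (B i) v = inner ℝ (B i) w) → v = w := by
    intro v w h
    apply B.repr.injective
    ext i
    simpa [B.repr_apply_apply] using h i
  have hnorm : ∀ v : E, ‖v‖ ^ 2 = ∑ i, inner ℝ (B i) v ^ 2 := by
    intro v
    rw [← B.sum_sq_norm_inner_right v]
    simp
  have hT : ∀ v, ‖T v‖ ^ 2 = ∑ i : Fin (n + 1), s i ^ 2 * inner ℝ (B i) v ^ 2 := by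
    intro v
    rw [← real_inner_self_eq_norm_sq, ← inner_adjoint_comp_self, ← hM,
      ← B.sum_inner_mul_inner]
    refine Finset.sum_congr rfl fun i _ => ?_
    rw [real_inner_comm, hrep]
    ring
  have hu0 : u ≠ 0 := by rintro rfl; simp at hu
  have hle : ∀ i : Fin (n + 1), s n ≤ s i := fun i => hanti (Nat.le_of_lt_succ i.2)
  have hBB : ∀ i j, inner ℝ (B i) (B j) = if i = j then (1 : ℝ) else 0 :=
    orthonormal_iff_ite.mp B.orthonormal
  set q : Fin (n + 1) := Fin.last n with hq
  have hall : ∀ v, s n ^ 2 * ‖v‖ ^ 2 ≤ ‖T v‖ ^ 2 := by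
    intro v
    rw [hT, hnorm, Finset.mul_sum]
    exact Finset.sum_le_sum fun i _ => mul_le_mul_of_nonneg_right
      (pow_le_pow_left₀ (hs0 n) (hle i) 2) (sq_nonneg _)
  have hTq : ‖T (B q)‖ ^ 2 = s n ^ 2 := by
    rw [hT]
    simp [hBB, hq]
  have hTu : ‖T u‖ ^ 2 = s n ^ 2 * ‖u‖ ^ 2 := by
    refine le_antisymm ?_ (hall u)
    have := rayleigh_le_of_forall_inner_ne_zero T hu hmin (B q)
    rwa [hTq, B.norm_eq_one, one_pow, mul_one] at this
  -- These nonnegative terms sum to `‖T u‖² - s n ^ 2 * ‖u‖² = 0`.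
  have hcoord : ∀ i : Fin (n + 1), (s i ^ 2 - s n ^ 2) * inner ℝ (B i) u ^ 2 = 0 := by
    have hsum : ∑ i : Fin (n + 1), (s i ^ 2 - s n ^ 2) * inner ℝ (B i) u ^ 2 = 0 := by
      simp_rw [sub_mul]
      rw [Finset.sum_sub_distrib, ← Finset.mul_sum, ← hT, ← hnorm, hTu, sub_self]
    have h0 := (Finset.sum_eq_zero_iff_of_nonneg fun i _ => mul_nonneg
      (sub_nonneg.mpr (pow_le_pow_left₀ (hs0 n) (hle i) 2)) (sq_nonneg _)).mp hsum
    exact fun i => h0 i (Finset.mem_univ i)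
  have hMu : M u = (s n ^ 2) • u := by
    refine hext _ _ fun i => ?_
    rw [hrep, inner_smul_right]
    have := hcoord i
    rcases mul_eq_zero.mp this with h | h
    · rw [sub_eq_zero.mp h]
    · rw [pow_eq_zero_iff two_ne_zero] at h
      rw [h, mul_zero, mul_zero]
  -- If the two were equal, their eigenvectors would span a plane, which meets `e⊥` in some `w ≠ 0`;
  -- then `u + w` would be a second minimizer on the same hyperplane.
  have hgap : s n < s (n - 1) := by
    refine lt_of_le_of_ne (hanti (Nat.sub_le n 1)) fun heq => ?_
    set p : Fin (n + 1) := ⟨n - 1, by omega⟩ with hp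
    have hpq : p ≠ q := by simp only [hp, hq, ne_eq, Fin.ext_iff, Fin.val_last]; omega
    obtain ⟨α, β, hne, hel⟩ : ∃ α β : ℝ, (α ≠ 0 ∨ β ≠ 0) ∧
        inner ℝ e (α • B p + β • B q) = 0 := by
      by_cases h1 : inner ℝ e (B q) = 0
      · exact ⟨0, 1, Or.inr one_ne_zero, by simp [h1]⟩
      · exact ⟨inner ℝ e (B q), -inner ℝ e (B p), Or.inl h1, by
          rw [inner_add_right, inner_smul_right, inner_smul_right]; ring⟩
    set w := α • B p + β • B q with hw
    have hwp : inner ℝ (B p) w = α := by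
      simp [hw, inner_add_right, inner_smul_right, hBB, hpq]
    have hwq : inner ℝ (B q) w = β := by
      simp [hw, inner_add_right, inner_smul_right, hBB, hpq.symm]
    have hMw : M w = (s n ^ 2) • w := by
      refine hext _ _ fun i => ?_
      rw [hrep, inner_smul_right]
      by_cases hi : i = p
      · rw [hi, heq]
      by_cases hi' : i = q
      · rw [hi']; simp [hq]
      · simp [hw, inner_add_right, inner_smul_right, hBB, hi, hi']
    have hTuw : ‖T (u + w)‖ ^ 2 = s n ^ 2 * ‖u + w‖ ^ 2 := by
      rw [← real_inner_self_eq_norm_sq, ← inner_adjoint_comp_self, ← hM, map_add, hMu, hMw,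
        ← smul_add, inner_smul_left, real_inner_self_eq_norm_sq]
      simp
    have hw0 : w = 0 := by
      refine add_eq_left.mp (huniq (u + w) ?_ (le_of_eq ?_))
      · rw [inner_add_right, hel, add_zero]
      · rw [hTuw, hTu]; ring
    rw [hw0, inner_zero_right] at hwp hwq
    rcases hne with h | h
    · exact h hwp.symm
    · exact h hwq.symm
  refine ⟨hgap, hMu, fun w hw => ?_⟩
  have hlt : ∀ i : Fin (n + 1), i ≠ q → s (n - 1) ≤ s i := by
    intro i hi
    refine hanti ?_
    have : i.val ≠ n := fun h => hi (Fin.ext h)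
    omega
  -- By the gap, `u` is a multiple of `B q`, so `w ⊥ u` only involves eigenvalues at least `s (n -
  -- 1) ^ 2`.
  have huz : ∀ i : Fin (n + 1), i ≠ q → inner ℝ (B i) u = 0 := by
    intro i hi
    have h1 : s n ^ 2 < s i ^ 2 := pow_lt_pow_left₀ (hgap.trans_le (hlt i hi)) (hs0 n) two_ne_zero
    have := (mul_eq_zero.mp (hcoord i)).resolve_left (sub_pos.mpr h1).ne'
    exact (pow_eq_zero_iff two_ne_zero).mp this
  have huq : inner ℝ (B q) u ≠ 0 := fun h => hu0 <| hext _ _ fun i => by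
    by_cases hi : i = q
    · rw [hi, h, inner_zero_right]
    · rw [huz i hi, inner_zero_right]
  have hwq : inner ℝ (B q) w = 0 := by
    rw [← B.sum_inner_mul_inner, Finset.sum_eq_single q] at hw
    · rw [real_inner_comm] at hw
      exact (mul_eq_zero.mp hw).resolve_left huq
    · intro i _ hi
      rw [real_inner_comm, huz i hi, zero_mul]
    · simp
  refine le_of_sq_le_sq ?_ (norm_nonneg _)
  rw [mul_pow, hnorm, hnorm, Finset.mul_sum]
  refine Finset.sum_le_sum fun i _ => ?_
  by_cases hi : i = q
  · rw [hi, hwq, hrep, hwq]; simp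
  · rw [hrep, mul_pow]
    exact mul_le_mul_of_nonneg_right (pow_le_pow_left₀ (sq_nonneg _)
      (pow_le_pow_left₀ (hs0 _) (hlt i hi) 2) 2) (sq_nonneg _)

end LinearAlgebra

/-! ### Homogeneous coordinates `(x, -1)` -/

section Augmented

variable {m n : ℕ}

/-- The vector `(y, t)`. -/
noncomputable def aug (y : EuclideanSpace ℝ (Fin n)) (t : ℝ) : EuclideanSpace ℝ (Fin n ⊕ Unit) :=
  WithLp.toLp 2 (Sum.elim y fun _ => t)

theorem exists_eq_aug (w : EuclideanSpace ℝ (Fin n ⊕ Unit)) : ∃ y t, w = aug y t := by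
  refine ⟨WithLp.toLp 2 fun i => w (Sum.inl i), w (Sum.inr ()), ?_⟩
  ext i
  rcases i with i | i <;> simp [aug]

theorem aug_add (y y' : EuclideanSpace ℝ (Fin n)) (t t' : ℝ) :
    aug y t + aug y' t' = aug (y + y') (t + t') := by
  ext i
  rcases i with i | i <;> simp [aug]

theorem smul_aug (c : ℝ) (y : EuclideanSpace ℝ (Fin n)) (t : ℝ) :
    c • aug y t = aug (c • y) (c * t) := by
  ext i
  rcases i with i | i <;> simp [aug]

theorem inner_aug (y y' : EuclideanSpace ℝ (Fin n)) (t t' : ℝ) :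
    inner ℝ (aug y t) (aug y' t') = inner ℝ y y' + t * t' := by
  simp [aug, PiLp.inner_apply, mul_comm]

theorem norm_sq_aug (y : EuclideanSpace ℝ (Fin n)) (t : ℝ) :
    ‖aug y t‖ ^ 2 = ‖y‖ ^ 2 + t ^ 2 := by
  rw [← real_inner_self_eq_norm_sq, inner_aug, real_inner_self_eq_norm_sq, sq t]

theorem aug_eq_zero {y : EuclideanSpace ℝ (Fin n)} (h : aug y 0 = 0) : y = 0 := by
  have := norm_sq_aug y 0
  rw [h] at this
  simpa using this.symm

theorem aug_sub (y y' : EuclideanSpace ℝ (Fin n)) (t t' : ℝ) :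
    aug y t - aug y' t' = aug (y - y') (t - t') := by
  ext i
  rcases i with i | i <;> simp [aug]

theorem norm_aug_zero (y : EuclideanSpace ℝ (Fin n)) : ‖aug y 0‖ = ‖y‖ := by
  rw [← sq_eq_sq₀ (norm_nonneg _) (norm_nonneg _), norm_sq_aug]
  simp

theorem norm_aug_neg_one (x : EuclideanSpace ℝ (Fin n)) : ‖aug x (-1)‖ = √(1 + inner ℝ x x) := by
  rw [← Real.sqrt_sq (norm_nonneg (aug x (-1))), norm_sq_aug, real_inner_self_eq_norm_sq]
  congr 1
  ring

theorem one_le_norm_aug (x : EuclideanSpace ℝ (Fin n)) : 1 ≤ ‖aug x (-1)‖ := by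
  rw [norm_aug_neg_one, Real.one_le_sqrt]
  linarith [real_inner_self_nonneg (F := EuclideanSpace ℝ (Fin n)) (x := x)]

theorem mu_eq (x : EuclideanSpace ℝ (Fin n)) : mu x = ‖aug x (-1)‖⁻¹ := by
  rw [mu, norm_aug_neg_one, one_div]

theorem mu_pos (x : EuclideanSpace ℝ (Fin n)) : 0 < mu x := by
  rw [mu_eq]
  exact inv_pos.mpr (one_pos.trans_le (one_le_norm_aug x))

theorem mu_sq_mul (x : EuclideanSpace ℝ (Fin n)) : mu x ^ 2 * (1 + ‖x‖ ^ 2) = 1 := by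
  have h := norm_sq_aug x (-1)
  rw [mu_eq, inv_pow, show 1 + ‖x‖ ^ 2 = ‖aug x (-1)‖ ^ 2 by rw [h]; ring]
  exact inv_mul_cancel₀ (pow_ne_zero 2 (one_pos.trans_le (one_le_norm_aug x)).ne')

theorem augment_toEuclideanLin_aug (E : Matrix (Fin m) (Fin n) ℝ) (f : EuclideanSpace ℝ (Fin m))
    (y : EuclideanSpace ℝ (Fin n)) (t : ℝ) :
    (augment E f).toEuclideanLin (aug y t) = E.toEuclideanLin y + t • f := by
  ext i
  simp [augment, aug, Matrix.toLpLin_apply, Matrix.mulVec,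
    dotProduct, mul_comm]

theorem resid_eq (A : Matrix (Fin m) (Fin n) ℝ) (b : EuclideanSpace ℝ (Fin m))
    (x : EuclideanSpace ℝ (Fin n)) :
    resid A b x = (augment A b).toEuclideanLin (‖aug x (-1)‖⁻¹ • aug x (-1)) := by
  rw [resid, mu_eq, map_smul, augment_toEuclideanLin_aug, neg_one_smul, sub_eq_add_neg]

theorem eta_eq (A : Matrix (Fin m) (Fin n) ℝ) (b : EuclideanSpace ℝ (Fin m))
    (x : EuclideanSpace ℝ (Fin n)) :
    eta A b x = ‖(augment A b).toEuclideanLin (aug x (-1))‖ / ‖aug x (-1)‖ := by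
  rw [eta, norm_aug_neg_one, augment_toEuclideanLin_aug, neg_one_smul, sub_eq_add_neg]

theorem jac_toEuclideanLin_apply (A : Matrix (Fin m) (Fin n) ℝ) (b : EuclideanSpace ℝ (Fin m))
    (x y : EuclideanSpace ℝ (Fin n)) :
    (jac A b x).toEuclideanLin y =
      mu x • A.toEuclideanLin y - (mu x ^ 3 * inner ℝ x y) • (A.toEuclideanLin x - b) := by
  ext i
  simp [jac, Matrix.toLpLin_apply,
    Matrix.vecMulVec_mulVec, PiLp.inner_apply, dotProduct, mul_comm]
  ring

/-- The linearised residual is the value of `(A | b)` at a point of the hyperplane of all `z` with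
`⟪z, (x, -1)⟫ = ‖(x, -1)‖²`. -/
theorem jac_add_resid (A : Matrix (Fin m) (Fin n) ℝ) (b : EuclideanSpace ℝ (Fin m))
    (x y : EuclideanSpace ℝ (Fin n)) :
    (jac A b x).toEuclideanLin y + resid A b x =
      mu x • (augment A b).toEuclideanLin (aug (y + stepDenom x y • x) (-stepDenom x y)) := by
  rw [jac_toEuclideanLin_apply, augment_toEuclideanLin_aug, resid, map_add, map_smul, stepDenom]
  module

end Augmented

/-! ### Total least squares as minimization of `η` -/

section Solution

variable {m n : ℕ} (A : Matrix (Fin m) (Fin n) ℝ) (b : EuclideanSpace ℝ (Fin m))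

section Frobenius

attribute [local instance] Matrix.frobeniusNormedAddCommGroup

theorem norm_augment_toEuclideanLin_le (w : EuclideanSpace ℝ (Fin n ⊕ Unit)) :
    ‖(augment A b).toEuclideanLin w‖ ≤ frobeniusNorm A b * ‖w‖ := by
  have h := Matrix.frobenius_norm_mul (augment A b) (Matrix.replicateCol Unit w)
  rw [← Matrix.replicateCol_mulVec, Matrix.frobenius_norm_replicateCol,
    Matrix.frobenius_norm_replicateCol] at h
  exact h

theorem frobeniusNorm_rank_one_le (c : ℝ) (r : EuclideanSpace ℝ (Fin m))
    (x : EuclideanSpace ℝ (Fin n)) :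
    frobeniusNorm (-(c • Matrix.vecMulVec r x)) (c • r) ≤ |c| * ‖r‖ * ‖aug x (-1)‖ := by
  have h : augment (-(c • Matrix.vecMulVec r x)) (c • r) =
      Matrix.replicateCol Unit (-(c • r)) * Matrix.replicateRow Unit (aug x (-1)) := by
    ext i j
    rcases j with j | j <;>
      simp [augment, aug, Matrix.mul_apply, Matrix.vecMulVec_apply, mul_assoc]
  rw [frobeniusNorm, h]
  refine (Matrix.frobenius_norm_mul _ _).trans (le_of_eq ?_)
  rw [Matrix.frobenius_norm_replicateCol, Matrix.frobenius_norm_replicateRow]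
  change ‖-(c • r)‖ * ‖aug x (-1)‖ = _
  rw [norm_neg, norm_smul, Real.norm_eq_abs]

end Frobenius

/-- The constraint says `(A | b)(x, -1) = -(E | f)(x, -1)`, and the Frobenius norm dominates the
operator norm. -/
theorem eta_le_frobeniusNorm {E : Matrix (Fin m) (Fin n) ℝ} {f : EuclideanSpace ℝ (Fin m)}
    {x : EuclideanSpace ℝ (Fin n)} (h : (A + E).toEuclideanLin x = b + f) :
    eta A b x ≤ frobeniusNorm E f := by
  have h1 : (augment A b).toEuclideanLin (aug x (-1)) =
      -(augment E f).toEuclideanLin (aug x (-1)) := by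
    rw [map_add, LinearMap.add_apply] at h
    rw [augment_toEuclideanLin_aug, augment_toEuclideanLin_aug, eq_sub_of_add_eq h]
    module
  rw [eta_eq, h1, norm_neg, div_le_iff₀ (one_pos.trans_le (one_le_norm_aug x))]
  exact norm_augment_toEuclideanLin_le E f _

/-- The witness is the rank-one matrix `-μ² r (x, -1)ᵀ` with `r = A x - b`, which cancels `(A | b)`
on the line through `(x, -1)`. -/
theorem exists_frobeniusNorm_le_eta (x : EuclideanSpace ℝ (Fin n)) :
    ∃ (E : Matrix (Fin m) (Fin n) ℝ) (f : EuclideanSpace ℝ (Fin m)),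
      (A + E).toEuclideanLin x = b + f ∧ frobeniusNorm E f ≤ eta A b x := by
  set r := A.toEuclideanLin x - b with hr
  refine ⟨-((mu x ^ 2) • Matrix.vecMulVec r x), (mu x ^ 2) • r, ?_, ?_⟩
  · have h1 : (Matrix.vecMulVec r x).toEuclideanLin x = ‖x‖ ^ 2 • r := by
      ext i
      simp [Matrix.toLpLin_apply, Matrix.vecMulVec_mulVec, dotProduct, mul_comm,
        EuclideanSpace.real_norm_sq_eq, pow_two (x _)]
    have h2 : (mu x ^ 2) • ‖x‖ ^ 2 • r = r - (mu x ^ 2) • r := by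
      have := mu_sq_mul x
      rw [smul_smul, show mu x ^ 2 * ‖x‖ ^ 2 = 1 - mu x ^ 2 by linarith, sub_smul, one_smul]
    rw [map_add, map_neg, map_smul, LinearMap.add_apply, LinearMap.neg_apply, LinearMap.smul_apply,
      h1, h2, hr]
    abel
  · refine (frobeniusNorm_rank_one_le _ _ _).trans (le_of_eq ?_)
    have := (one_pos.trans_le (one_le_norm_aug x)).ne'
    rw [eta, ← norm_aug_neg_one, abs_of_nonneg (sq_nonneg _), mu_eq]
    field_simp
    rw [hr]

/-- The total least squares solutions are the minimizers of `η`. -/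
theorem isSolution_iff (x : EuclideanSpace ℝ (Fin n)) :
    IsSolution A b x ↔ ∀ y, eta A b x ≤ eta A b y := by
  constructor
  · rintro ⟨E, f, hmin, hx⟩ y
    obtain ⟨E', f', hy, hle⟩ := exists_frobeniusNorm_le_eta A b y
    exact ((eta_le_frobeniusNorm A b hx).trans (hmin.2 E' f' ⟨y, hy⟩)).trans hle
  · intro h
    obtain ⟨E, f, hx, hle⟩ := exists_frobeniusNorm_le_eta A b x
    refine ⟨E, f, ⟨⟨x, hx⟩, ?_⟩, hx⟩
    rintro E' f' ⟨y, hy⟩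
    exact (hle.trans (h y)).trans (eta_le_frobeniusNorm A b hy)

end Solution

/-! ### Gauss-Newton steps as inverse iteration -/

section GaussNewton

variable {m n : ℕ} (A : Matrix (Fin m) (Fin n) ℝ) (b : EuclideanSpace ℝ (Fin m))

theorem eta_le_eta_iff (x y : EuclideanSpace ℝ (Fin n)) :
    eta A b x ≤ eta A b y ↔
      ‖(augment A b).toEuclideanLin (aug x (-1))‖ ^ 2 * ‖aug y (-1)‖ ^ 2 ≤
        ‖(augment A b).toEuclideanLin (aug y (-1))‖ ^ 2 * ‖aug x (-1)‖ ^ 2 := by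
  rw [eta_eq, eta_eq, div_le_div_iff₀ (one_pos.trans_le (one_le_norm_aug x))
    (one_pos.trans_le (one_le_norm_aug y)), ← mul_pow, ← mul_pow, sq_le_sq₀] <;> positivity

/-- Vectors outside `e⊥` rescale to the form `(y, -1)`, where the Rayleigh quotient is `η(y)²`. By
the index shift, `sigma A b (n + 1)` is `singularValues n`. -/
theorem spectral_gap (hn : 1 ≤ n) (hwp : WellPosed A b) {u : EuclideanSpace ℝ (Fin n)}
    (hu : IsSolution A b u) :
    sigma A b (n + 1) < sigma A b n ∧
    ((augment A b).toEuclideanLin.adjoint ∘ₗ (augment A b).toEuclideanLin) (aug u (-1)) =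
      (sigma A b (n + 1) ^ 2) • aug u (-1) ∧
    ∀ w, inner ℝ (aug u (-1)) w = 0 → sigma A b n ^ 2 * ‖w‖ ≤
      ‖((augment A b).toEuclideanLin.adjoint ∘ₗ (augment A b).toEuclideanLin) w‖ := by
  have hdim : Module.finrank ℝ (EuclideanSpace ℝ (Fin n ⊕ Unit)) = n + 1 := by simp
  have hu' := (isSolution_iff A b u).mp hu
  refine spectral_gap_of_unique_minimizer (augment A b).toEuclideanLin hn hdim (e := aug 0 1)
    (by simp [inner_aug]) ?_ ?_
  · intro v hv
    obtain ⟨y, t, rfl⟩ := exists_eq_aug v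
    have ht : t ≠ 0 := by simpa [inner_aug] using hv
    have hy : aug y t = (-t) • aug (-t⁻¹ • y) (-1) := by
      rw [smul_aug, smul_smul]
      simp [ht]
    rw [hy, map_smul, norm_smul, norm_smul, mul_pow, mul_pow, mul_assoc, mul_left_comm]
    exact mul_le_mul_of_nonneg_left ((eta_le_eta_iff A b _ _).mp (hu' _)) (sq_nonneg _)
  · intro v hv hle
    obtain ⟨y, t, rfl⟩ := exists_eq_aug v
    obtain rfl : t = -1 := by simpa [inner_aug] using hv
    rw [hwp.unique hu ((isSolution_iff A b y).mpr
      fun z => ((eta_le_eta_iff A b _ _).mpr hle).trans (hu' z))]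

/-- The residual normal equation of the least squares problem, in terms of `(A | b)`. -/
theorem exists_normal_equation_init {x : EuclideanSpace ℝ (Fin n)}
    (hx : ∀ y : EuclideanSpace ℝ (Fin n), ‖A.toEuclideanLin x - b‖ ≤ ‖A.toEuclideanLin y - b‖) :
    ∃ c : ℝ, ((augment A b).toEuclideanLin.adjoint ∘ₗ (augment A b).toEuclideanLin) (aug x (-1)) =
      c • aug 0 1 := by
  refine exists_eq_smul_of_forall_inner_eq_zero
    (fun h => by simpa [h] using norm_sq_aug (0 : EuclideanSpace ℝ (Fin n)) 1) fun w hw => ?_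
  obtain ⟨y, t, rfl⟩ := exists_eq_aug w
  obtain rfl : t = 0 := by simpa [inner_aug] using hw
  rw [inner_adjoint_comp_self]
  refine inner_eq_zero_of_norm_le_add_smul fun s => ?_
  rw [← map_smul, ← map_add, smul_aug, aug_add, augment_toEuclideanLin_aug,
    augment_toEuclideanLin_aug, mul_zero, add_zero, neg_one_smul, ← sub_eq_add_neg,
    ← sub_eq_add_neg]
  exact hx _

/-- The normal equation of the Gauss-Newton step: up to scaling, the step with optimal length is a
step of inverse iteration. -/
theorem exists_normal_equation_step {x h : EuclideanSpace ℝ (Fin n)}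
    (hh : ∀ y : EuclideanSpace ℝ (Fin n), ‖(jac A b x).toEuclideanLin h + resid A b x‖ ≤
      ‖(jac A b x).toEuclideanLin y + resid A b x‖) :
    ∃ c : ℝ, ((augment A b).toEuclideanLin.adjoint ∘ₗ (augment A b).toEuclideanLin)
      (aug (h + stepDenom x h • x) (-stepDenom x h)) = c • aug x (-1) := by
  have hx0 : aug x (-1) ≠ 0 := norm_ne_zero_iff.mp (one_pos.trans_le (one_le_norm_aug x)).ne'
  refine exists_eq_smul_of_forall_inner_eq_zero hx0 fun w hw => ?_
  obtain ⟨p, q, rfl⟩ := exists_eq_aug w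
  have hq : inner ℝ x p = q := by
    rw [inner_aug] at hw
    linarith
  rw [inner_adjoint_comp_self]
  refine inner_eq_zero_of_norm_le_add_smul fun t => ?_
  -- The direction `p + q • x` is chosen so that `z` moves by exactly `t • (p, q)`.
  have hd : stepDenom x (h + t • (p + q • x)) = stepDenom x h - t * q := by
    have := mu_sq_mul x
    simp only [stepDenom, inner_add_right, inner_smul_right, hq, real_inner_self_eq_norm_sq]
    linear_combination -t * q * this
  have h1 := hh (h + t • (p + q • x))
  rw [jac_add_resid, jac_add_resid, norm_smul, norm_smul, hd] at h1
  have h2 := le_of_mul_le_mul_left h1 (norm_pos_iff.mpr (mu_pos x).ne')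
  rw [← map_smul, ← map_add, smul_aug, aug_add]
  rwa [show h + stepDenom x h • x + t • p = h + t • (p + q • x) + (stepDenom x h - t * q) • x by
    module, show -stepDenom x h + t * q = -(stepDenom x h - t * q) by ring]

/-- As long as `(A | b)` has full column rank, the Gauss-Newton iteration with optimal step length
is inverse iteration started at the last coordinate vector. -/
theorem IsRun.inverse_iteration {x h : ℕ → EuclideanSpace ℝ (Fin n)} (hrun : IsRun A b x h)
    (hinj : Function.Injective (augment A b).toEuclideanLin) (k : ℕ) :
    stepDenom (x k) (h k) ≠ 0 ∧ ∃ c : ℝ, c ≠ 0 ∧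
      (((augment A b).toEuclideanLin.adjoint ∘ₗ (augment A b).toEuclideanLin) ^ (k + 1))
        (aug (x k) (-1)) = c • aug 0 1 := by
  set M := (augment A b).toEuclideanLin.adjoint ∘ₗ (augment A b).toEuclideanLin with hM
  have hMinj : ∀ v, M v = 0 → v = 0 := fun v hv =>
    eq_zero_of_inner_pow_adjoint_comp_self hinj 1 v (by rw [pow_one, ← hM, hv, inner_zero_left])
  have hx0 : ∀ y : EuclideanSpace ℝ (Fin n), aug y (-1) ≠ 0 := fun y =>
    norm_ne_zero_iff.mp (one_pos.trans_le (one_le_norm_aug y)).ne'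
  have hstep : ∀ k (c : ℝ), c ≠ 0 → (M ^ (k + 1)) (aug (x k) (-1)) = c • aug 0 1 →
      stepDenom (x k) (h k) ≠ 0 ∧ ∃ d : ℝ, d ≠ 0 ∧
        (M ^ (k + 2)) (aug (h k + stepDenom (x k) (h k) • x k) (-stepDenom (x k) (h k))) =
          d • aug 0 1 := by
    intro k c hc hk
    obtain ⟨l, hl⟩ := exists_normal_equation_step A b (hrun.step k)
    set z := aug (h k + stepDenom (x k) (h k) • x k) (-stepDenom (x k) (h k)) with hz
    have hMz : (M ^ (k + 2)) z = (l * c) • aug 0 1 := by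
      rw [pow_succ, Module.End.mul_apply, hl, map_smul, hk, smul_smul]
    -- `⟪z, (x k, -1)⟫ = 1 + ‖x k‖²`, a hyperplane missing the origin.
    have hz0 : z ≠ 0 := by
      intro h0
      have h1 : inner ℝ z (aug (x k) (-1)) = 1 + ‖x k‖ ^ 2 := by
        have := mu_sq_mul (x k)
        rw [hz, inner_aug, inner_add_left, inner_smul_left, real_inner_self_eq_norm_sq, stepDenom,
          real_inner_comm]
        simp only [conj_trivial]
        linear_combination -inner ℝ (x k) (h k) * this
      rw [h0, inner_zero_left] at h1
      nlinarith [sq_nonneg ‖x k‖]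
    have hl0 : l ≠ 0 := by
      rintro rfl
      rw [zero_smul] at hl
      exact hz0 (hMinj _ hl)
    -- A zero denominator means `⟪e, z⟫ = 0`, hence `⟪M ^ (k + 2) z, z⟫ = 0`, against positive
    -- definiteness.
    refine ⟨fun hd => hz0 ?_, l * c, mul_ne_zero hl0 hc, hMz⟩
    refine eq_zero_of_inner_pow_adjoint_comp_self hinj (k + 2) z ?_
    rw [← hM, hMz, inner_smul_left, hz, inner_aug, hd]
    simp
  have hmain : ∀ k, ∃ c : ℝ, c ≠ 0 ∧ (M ^ (k + 1)) (aug (x k) (-1)) = c • aug 0 1 := by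
    intro k
    induction k with
    | zero =>
      obtain ⟨c, hc⟩ := exists_normal_equation_init A b hrun.init
      refine ⟨c, ?_, by rw [zero_add, pow_one, hM, hc]⟩
      rintro rfl
      rw [zero_smul] at hc
      exact hx0 _ (hMinj _ hc)
    | succ k ih =>
      obtain ⟨c, hc, hk⟩ := ih
      obtain ⟨hd, d, hd0, hdk⟩ := hstep k c hc hk
      refine ⟨(stepDenom (x k) (h k))⁻¹ * d, mul_ne_zero (inv_ne_zero hd) hd0, ?_⟩
      have h1 : aug (x (k + 1)) (-1) = (stepDenom (x k) (h k))⁻¹ •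
          aug (h k + stepDenom (x k) (h k) • x k) (-stepDenom (x k) (h k)) := by
        rw [smul_aug, hrun.update k, stepLength, smul_add, smul_smul, inv_mul_cancel₀ hd, one_smul,
          mul_neg, inv_mul_cancel₀ hd, one_div, add_comm]
      rw [h1, map_smul, hdk, smul_smul]
  obtain ⟨c, hc, hk⟩ := hmain k
  exact ⟨(hstep k c hc hk).1, c, hc, hk⟩

/-- If `b = A u` with `A` injective, all iterates coincide with `u`. -/
theorem IsRun.eq_of_consistent {x h : ℕ → EuclideanSpace ℝ (Fin n)} (hrun : IsRun A b x h)
    {u : EuclideanSpace ℝ (Fin n)} (hu : A.toEuclideanLin u = b)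
    (hA : Function.Injective A.toEuclideanLin) (k : ℕ) : x k = u ∧ h k = 0 := by
  have hstep : ∀ k, x k = u → h k = 0 := by
    intro k hk
    have h1 := hrun.step k 0
    have h2 : A.toEuclideanLin u - b = 0 := by rw [hu, sub_self]
    rw [resid, hk, h2, smul_zero, map_zero, add_zero, add_zero, norm_zero, norm_le_zero_iff,
      jac_toEuclideanLin_apply, h2, smul_zero, sub_zero,
      smul_eq_zero_iff_right (mu_pos u).ne'] at h1
    exact (map_eq_zero_iff _ hA).mp h1
  have hx : x k = u := by
    induction k with
    | zero =>
      have h1 := hrun.init u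
      rw [hu, sub_self, norm_zero, norm_le_zero_iff, sub_eq_zero, ← hu] at h1
      exact hA h1
    | succ k ih => rw [hrun.update, hstep k ih, smul_zero, add_zero, ih]
  exact ⟨hx, hstep k hx⟩

end GaussNewton

/-! ### From eigenvector errors to residuals and Rayleigh quotients -/

section Convergence

/-- Normalisation is Lipschitz outside the unit ball. -/
theorem norm_normalize_sub_le {E : Type*} [NormedAddCommGroup E] [NormedSpace ℝ E] {p q : E}
    (hp : 1 ≤ ‖p‖) (hq : q ≠ 0) : ‖‖p‖⁻¹ • p - ‖q‖⁻¹ • q‖ ≤ 2 * ‖p - q‖ := by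
  have hp0 : 0 < ‖p‖ := one_pos.trans_le hp
  have hq0 : 0 < ‖q‖ := norm_pos_iff.mpr hq
  have h1 : ‖p‖⁻¹ • p - ‖q‖⁻¹ • q = ‖p‖⁻¹ • ((p - q) + ((‖q‖ - ‖p‖) / ‖q‖) • q) := by
    have : ‖p‖⁻¹ * ((‖q‖ - ‖p‖) / ‖q‖) = ‖p‖⁻¹ - ‖q‖⁻¹ := by field_simp
    rw [smul_add, smul_smul, this]
    module
  rw [h1, norm_smul, norm_inv, norm_norm]
  have h2 : ‖((‖q‖ - ‖p‖) / ‖q‖) • q‖ ≤ ‖p - q‖ := by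
    rw [norm_smul, norm_div, norm_norm, div_mul_cancel₀ _ hq0.ne', Real.norm_eq_abs, norm_sub_rev]
    exact abs_norm_sub_norm_le q p
  calc ‖p‖⁻¹ * ‖(p - q) + ((‖q‖ - ‖p‖) / ‖q‖) • q‖
      ≤ 1 * ‖(p - q) + ((‖q‖ - ‖p‖) / ‖q‖) • q‖ :=
        mul_le_mul_of_nonneg_right (inv_le_one_of_one_le₀ hp) (norm_nonneg _)
    _ ≤ ‖p - q‖ + ‖((‖q‖ - ‖p‖) / ‖q‖) • q‖ := by rw [one_mul]; exact norm_add_le _ _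
    _ ≤ 2 * ‖p - q‖ := by linarith

/-- The Rayleigh quotient depends quadratically on the component orthogonal to an eigenvector. -/
theorem abs_norm_div_norm_sub_le {E F : Type*} [NormedAddCommGroup E] [InnerProductSpace ℝ E]
    [NormedAddCommGroup F] [InnerProductSpace ℝ F] [FiniteDimensional ℝ E] [FiniteDimensional ℝ F]
    {T : E →ₗ[ℝ] F} {u w v : E} {σ a L : ℝ} (hσ : 0 < σ)
    (hMu : (T.adjoint ∘ₗ T) u = σ ^ 2 • u) (hw : inner ℝ u w = 0) (hv : v = a • u + w)
    (hv1 : 1 ≤ ‖v‖) (hL : ‖T w‖ ≤ L * ‖w‖) :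
    |‖T v‖ / ‖v‖ - σ| ≤ (L ^ 2 + σ ^ 2) / σ * ‖w‖ ^ 2 := by
  set η := ‖T v‖ / ‖v‖ with hη
  have hv0 : 0 < ‖v‖ := one_pos.trans_le hv1
  have hη0 : 0 ≤ η := by positivity
  have hηv : ‖T v‖ = η * ‖v‖ := by rw [hη, div_mul_cancel₀ _ hv0.ne']
  have hTuw : inner ℝ (T u) (T w) = 0 := by
    rw [← inner_adjoint_comp_self, hMu, inner_smul_left, hw, mul_zero]
  have hTu : ‖T u‖ ^ 2 = σ ^ 2 * ‖u‖ ^ 2 := by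
    rw [← real_inner_self_eq_norm_sq, ← inner_adjoint_comp_self, hMu, inner_smul_left,
      real_inner_self_eq_norm_sq]
    simp
  have h1 : ‖v‖ ^ 2 = a ^ 2 * ‖u‖ ^ 2 + ‖w‖ ^ 2 := by
    rw [hv, norm_add_sq_real, inner_smul_left, hw, norm_smul, mul_pow, Real.norm_eq_abs, sq_abs]
    ring
  have h2 : ‖T v‖ ^ 2 = a ^ 2 * (σ ^ 2 * ‖u‖ ^ 2) + ‖T w‖ ^ 2 := by
    rw [hv, map_add, map_smul, norm_add_sq_real, inner_smul_left, hTuw, norm_smul, mul_pow,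
      Real.norm_eq_abs, sq_abs, hTu]
    ring
  -- The contributions of `u` cancel, leaving only terms quadratic in `w`.
  have h3 : (η - σ) * ((η + σ) * ‖v‖ ^ 2) = ‖T w‖ ^ 2 - σ ^ 2 * ‖w‖ ^ 2 := by
    rw [hηv, mul_pow] at h2
    linear_combination h2 - σ ^ 2 * h1
  have h4 : ‖T w‖ ^ 2 ≤ L ^ 2 * ‖w‖ ^ 2 := by
    rw [← mul_pow]
    exact pow_le_pow_left₀ (norm_nonneg _) hL 2
  have h5 : σ ≤ (η + σ) * ‖v‖ ^ 2 := by
    have h6 : 1 ≤ ‖v‖ ^ 2 := one_le_pow₀ hv1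
    nlinarith [mul_nonneg hη0 (sq_nonneg ‖v‖)]
  rw [div_mul_eq_mul_div, le_div_iff₀ hσ]
  calc |η - σ| * σ ≤ |η - σ| * ((η + σ) * ‖v‖ ^ 2) :=
        mul_le_mul_of_nonneg_left h5 (abs_nonneg _)
    _ = |(η - σ) * ((η + σ) * ‖v‖ ^ 2)| := by
        rw [abs_mul, abs_of_nonneg (hσ.le.trans h5)]
    _ ≤ (L ^ 2 + σ ^ 2) * ‖w‖ ^ 2 := by
        rw [h3, abs_le]
        constructor <;> nlinarith [sq_nonneg ‖T w‖, sq_nonneg (L * ‖w‖), sq_nonneg (σ * ‖w‖)]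

end Convergence

/-! ### The cases `σ_{n+1} > 0` and `σ_{n+1} = 0` -/

section Iterates

variable {m n : ℕ} {A : Matrix (Fin m) (Fin n) ℝ} {b : EuclideanSpace ℝ (Fin m)}

/-- Inverse iteration applies with `τ = σ_{n+1}²` and `κ = σ_n²`, whence the exponent `2 * k`. The
component of `e` along `(u, -1)` is nonzero because `⟪e, (u, -1)⟫ = -1`. -/
theorem IsRun.convergence_of_sigma_pos (hn : 1 ≤ n) (hwp : WellPosed A b)
    {u : EuclideanSpace ℝ (Fin n)} (hu : IsSolution A b u)
    {x h : ℕ → EuclideanSpace ℝ (Fin n)} (hrun : IsRun A b x h) (hσ : 0 < sigma A b (n + 1)) :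
    (∀ k : ℕ, stepDenom (x k) (h k) ≠ 0) ∧
    (fun k : ℕ => ‖resid A b (x k) - resid A b u‖) =O[atTop]
      (fun k : ℕ => (sigma A b (n + 1) / sigma A b n) ^ (2 * k)) ∧
    (fun k : ℕ => |eta A b (x k) - sigma A b (n + 1)|) =O[atTop]
      (fun k : ℕ => (sigma A b (n + 1) / sigma A b n) ^ (4 * k)) ∧
    (fun k : ℕ => ‖x k - u‖) =O[atTop]
      (fun k : ℕ => (sigma A b (n + 1) / sigma A b n) ^ (2 * k)) := by
  obtain ⟨hgap, hMu, hexp⟩ := spectral_gap A b hn hwp hu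
  set T := (augment A b).toEuclideanLin with hT
  have hdim : Module.finrank ℝ (EuclideanSpace ℝ (Fin n ⊕ Unit)) = n + 1 := by simp
  have hinj : Function.Injective T := by
    rw [LinearMap.injective_iff_forall_lt_finrank_singularValues_pos, hdim]
    intro i hi
    exact hσ.trans_le (T.singularValues_antitone (by omega))
  have hinv := hrun.inverse_iteration A b hinj
  choose hden c _ hc using hinv
  refine ⟨hden, ?_⟩
  have he : ∀ y : EuclideanSpace ℝ (Fin n),
      inner ℝ (aug 0 1) (aug y (-1)) = (-1 : ℝ) := by simp [inner_aug]
  obtain ⟨a, w, hvaw, hwu, hwO, haO⟩ := inverse_iteration_convergence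
    T.isSymmetric_adjoint_comp_self hMu (pow_pos hσ 2)
    (pow_lt_pow_left₀ hgap hσ.le two_ne_zero) hexp (e := aug 0 1) (by rw [he]; norm_num)
    (v := fun k => aug (x k) (-1)) (fun k => by rw [he, he]) hc
  have hrate : (fun k : ℕ => (sigma A b (n + 1) ^ 2 / sigma A b n ^ 2) ^ k) =
      fun k : ℕ => (sigma A b (n + 1) / sigma A b n) ^ (2 * k) := by
    funext k
    rw [← div_pow, pow_mul]
  rw [hrate] at hwO haO
  have hvO : (fun k => aug (x k) (-1) - aug u (-1)) =O[atTop]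
      fun k : ℕ => (sigma A b (n + 1) / sigma A b n) ^ (2 * k) := by
    have h1 : (fun k => aug (x k) (-1) - aug u (-1)) =
        fun k => (a k - 1) • aug u (-1) + w k := by
      funext k
      rw [show aug (x k) (-1) = a k • aug u (-1) + w k from hvaw k]
      module
    rw [h1]
    refine IsBigO.add ?_ hwO
    refine (IsBigO.of_bound ‖aug u (-1)‖ (Eventually.of_forall fun k => ?_)).trans haO
    rw [norm_smul, mul_comm]
  set Tc := LinearMap.toContinuousLinearMap T with hTc
  have hbd : ∀ y, ‖T y‖ ≤ ‖Tc‖ * ‖y‖ := Tc.le_opNorm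
  refine ⟨?_, ?_, ?_⟩
  · refine (IsBigO.of_bound (‖Tc‖ * 2) (Eventually.of_forall fun k => ?_)).trans hvO
    rw [norm_norm, resid_eq, resid_eq, ← map_sub, mul_assoc]
    exact (hbd _).trans (mul_le_mul_of_nonneg_left (norm_normalize_sub_le (one_le_norm_aug _)
      (norm_ne_zero_iff.mp (one_pos.trans_le (one_le_norm_aug u)).ne')) (norm_nonneg _))
  · have h2 : (fun k : ℕ => ‖w k‖ ^ 2) =O[atTop]
        fun k : ℕ => (sigma A b (n + 1) / sigma A b n) ^ (4 * k) := by
      have h3 : (fun k : ℕ => (sigma A b (n + 1) / sigma A b n) ^ (4 * k)) =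
          fun k : ℕ => ((sigma A b (n + 1) / sigma A b n) ^ (2 * k)) ^ 2 := by
        funext k
        rw [← pow_mul]
        congr 1
        ring
      rw [h3]
      exact hwO.norm_left.pow 2
    refine (IsBigO.of_bound ((‖Tc‖ ^ 2 + sigma A b (n + 1) ^ 2) / sigma A b (n + 1))
      (Eventually.of_forall fun k => ?_)).trans h2
    rw [Real.norm_eq_abs, abs_abs, eta_eq, Real.norm_of_nonneg (sq_nonneg _)]
    exact abs_norm_div_norm_sub_le hσ hMu (hwu k) (hvaw k) (one_le_norm_aug _) (hbd _)
  · refine (IsBigO.of_bound 1 (Eventually.of_forall fun k => ?_)).trans hvO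
    rw [norm_norm, one_mul, aug_sub, sub_self, norm_aug_zero]

/-- By the gap, the kernel of `(A | b)` is the line through `(u, -1)`, which contains no `(y, 0)`
with `y ≠ 0`. -/
theorem consistent_of_sigma_eq_zero (hn : 1 ≤ n) (hwp : WellPosed A b)
    {u : EuclideanSpace ℝ (Fin n)} (hu : IsSolution A b u) (hσ : sigma A b (n + 1) = 0) :
    A.toEuclideanLin u = b ∧ Function.Injective A.toEuclideanLin := by
  obtain ⟨hgap, hMu, hexp⟩ := spectral_gap A b hn hwp hu
  set T := (augment A b).toEuclideanLin with hT
  rw [hσ] at hgap hMu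
  rw [zero_pow two_ne_zero, zero_smul] at hMu
  have hTu : T (aug u (-1)) = 0 := by
    rw [← inner_self_eq_zero (𝕜 := ℝ), ← inner_adjoint_comp_self, hMu, inner_zero_left]
  constructor
  · rw [hT, augment_toEuclideanLin_aug, neg_one_smul, ← sub_eq_add_neg] at hTu
    exact sub_eq_zero.mp hTu
  · rw [injective_iff_map_eq_zero]
    intro y hy
    have hTy : T (aug y 0) = 0 := by
      rw [hT, augment_toEuclideanLin_aug, hy, zero_smul, add_zero]
    set s := inner ℝ (aug u (-1)) (aug y 0) / ‖aug u (-1)‖ ^ 2 with hs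
    have hu0 : ‖aug u (-1)‖ ≠ 0 := (one_pos.trans_le (one_le_norm_aug u)).ne'
    have horth : inner ℝ (aug u (-1)) (aug y 0 - s • aug u (-1)) = 0 := by
      rw [inner_sub_right, inner_smul_right, real_inner_self_eq_norm_sq, hs,
        div_mul_cancel₀ _ (pow_ne_zero 2 hu0), sub_self]
    have h1 := hexp _ horth
    rw [map_sub, map_smul, hMu, LinearMap.comp_apply, hTy, map_zero, smul_zero, sub_zero,
      norm_zero] at h1
    have h2 : ‖aug y 0 - s • aug u (-1)‖ = 0 :=
      le_antisymm (nonpos_of_mul_nonpos_right h1 (pow_pos hgap 2)) (norm_nonneg _)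
    have h3 := norm_eq_zero.mp h2
    have h4 := congrArg (fun v => inner ℝ (aug (0 : EuclideanSpace ℝ (Fin n)) 1) v) h3
    simp only [inner_sub_right, inner_smul_right, inner_aug, inner_zero_left,
      inner_zero_right] at h4
    have h5 : s = 0 := by linarith
    rw [h5, zero_smul, sub_zero] at h3
    exact aug_eq_zero h3

end Iterates
end TLS

theorem mainTheorem1 {m n : ℕ} (hn : 1 ≤ n) (hmn : n ≤ m)
    (A : Matrix (Fin m) (Fin n) ℝ) (b : EuclideanSpace ℝ (Fin m))
    (hwp : TLS.WellPosed A b)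
    (xTLS : EuclideanSpace ℝ (Fin n)) (hTLS : TLS.IsSolution A b xTLS)
    (x h : ℕ → EuclideanSpace ℝ (Fin n)) (hrun : TLS.IsRun A b x h) :
    TLS.sigma A b (n + 1) < TLS.sigma A b n ∧
    (∀ k : ℕ, TLS.stepDenom (x k) (h k) ≠ 0) ∧
    (fun k : ℕ => ‖TLS.resid A b (x k) - TLS.resid A b xTLS‖) =O[atTop]
      (fun k : ℕ => (TLS.sigma A b (n + 1) / TLS.sigma A b n) ^ (2 * k)) ∧
    (fun k : ℕ => |TLS.eta A b (x k) - TLS.sigma A b (n + 1)|) =O[atTop]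
      (fun k : ℕ => (TLS.sigma A b (n + 1) / TLS.sigma A b n) ^ (4 * k)) ∧
    (fun k : ℕ => ‖x k - xTLS‖) =O[atTop]
      (fun k : ℕ => (TLS.sigma A b (n + 1) / TLS.sigma A b n) ^ (2 * k)) := by
  refine ⟨(TLS.spectral_gap A b hn hwp hTLS).1, ?_⟩
  have hσ : 0 ≤ TLS.sigma A b (n + 1) := LinearMap.singularValues_nonneg _ _
  -- When `σ_{n+1} = 0` all three error sequences vanish identically, so the rate plays no role.
  rcases hσ.lt_or_eq with hpos | hzero
  · exact hrun.convergence_of_sigma_pos hn hwp hTLS hpos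
  · obtain ⟨hb, hA⟩ := TLS.consistent_of_sigma_eq_zero hn hwp hTLS hzero.symm
    have hk := hrun.eq_of_consistent A b hb hA
    have heta : TLS.eta A b xTLS = 0 := by rw [TLS.eta, hb, sub_self, norm_zero, zero_div]
    refine ⟨fun k => ?_, ?_, ?_, ?_⟩
    · rw [TLS.stepDenom, (hk k).2, inner_zero_right, mul_zero, sub_zero]
      exact one_ne_zero
    · simp_rw [(hk _).1, sub_self, norm_zero]
      exact isBigO_zero _ _
    · simp_rw [(hk _).1, heta, ← hzero, sub_self, abs_zero]
      exact isBigO_zero _ _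
    · simp_rw [(hk _).1, sub_self, norm_zero]
      exact isBigO_zero _ _
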